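/- Consider online $b$-matching with stochastic rewards. An input $G$ consists of a finite set $S$ of servers, known in advance, each of which can be matched at most $b$ times, and a finite sequence $R$ of requests arriving one by one. When $r\in R$ arrives, its incident edges $\{s,r\}\in E$ and their success probabilities $p_{s,r}\in[0,1]$ are revealed, and a (randomized) online algorithm, knowing only what has been observed so far, irrevocably assigns $r$ to a neighbor with remaining capacity or leaves it unassigned. An assignment of $r$ to $s$ becomes a match with probability $p_{s,r}$, independently of the past; otherwise $r$ leaves and the remaining capacity of $s$ is unchanged. The algorithm learns the outcome after the assignment. Let $\mathbb{E}[\mathrm{Alg}(G)]$ be the expected number of matches. Let $\mathrm{Opt}(G)$ be the optimum of the fractional budgeted allocation problem $$\max \sum_{\{s,r\}\in E} p_{s,r}\,m(s,r)\quad\text{s.t.}\quad \sum_{r:\{s,r\}\in E} p_{s,r}\,m(s,r)\le b\ (s\in S),\quad \sum_{s:\{s,r\}\in E} m(s,r)\le 1\ (r\in R),\quad m\ge 0 .$$ An algorithm is $c$-competitive against $\mathrm{Opt}$ on a class of inputs if $\mathbb{E}[\mathrm{Alg}(G)]\ge c\cdot \mathrm{Opt}(G)$ for all $G$ in the class. Then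 for every integer $b\ge 1$, no randomized online algorithm achieves a competitive ratio greater than $1-1/e$ against $\mathrm{Opt}$, even for equal and vanishing edge probabilities: for every $b\ge1$ and every $c>1-1/e$ there is $p_0>0$ such that for every $p\in(0,p_0)$ no randomized online algorithm (even one designed for these $b$, $c$ and $p$) is $c$-competitive against $\mathrm{Opt}$ on the class of inputs in which every edge has success probability $p$. -/

import Mathlib

open Filter Topology
open scoped ENNReal

noncomputable section

namespace OnlineBMatching

/-- A request, as revealed on arrival: `r s = some q` means that there is an edge to server `s`
with success probability `q`; `r s = none` means that there is no edge to `s`. -/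
abbrev Request (n : ℕ) : Type := Fin n → Option unitInterval

/-- An input: a bipartite graph with `numServers` servers and `numRequests` requests, which arrive
in the order of their indices, together with the success probabilities of the edges. -/
structure Input where
  numServers : ℕ
  numRequests : ℕ
  request : Fin numRequests → Request numServers

/-- What is recorded about one arrival: the request, the server chosen by the algorithm
(`none` if the request is left unassigned), and whether the assignment succeeded. -/
structure Step (n : ℕ) where
  request : Request n
  choice : Option (Fin n)
  success : Bool

/-- The history of the arrivals so far, most recent one first. -/
abbrev History (n : ℕ) : Type := List (Step n)

/-- A randomized online algorithm. The set of servers is known in advance. When a request arrives,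
the algorithm draws a server (or `none`) from a distribution that may depend on everything observed
so far: the earlier requests with their edges and probabilities, the algorithm's own earlier random
choices, the outcomes of the earlier assignments, and the current request. Nothing about later
requests, including their number, is available. -/
abbrev Algorithm : Type := (n : ℕ) → History n → Request n → PMF (Option (Fin n))

/-- The number of times that server `s` has been matched. -/
def matchesOf {n : ℕ} (h : History n) (s : Fin n) : ℕ :=
  h.countP fun t => t.choice = some s ∧ t.success = true

/-- The total number of matches. -/
def totalMatches {n : ℕ} (h : History n) : ℕ :=
  h.countP fun t => t.success

/-- A coin that shows `true` with probability `q`. -/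
def coin (q : unitInterval) : PMF Bool :=
  PMF.ofFintype (fun x => ENNReal.ofReal (if x then (q : ℝ) else 1 - q)) (by
    rw [Fintype.sum_bool, if_pos rfl, if_neg Bool.false_ne_true,
      ← ENNReal.ofReal_add q.2.1 (sub_nonneg.2 q.2.2)]
    simp)

/-- The law of the outcome of choosing `a` for the request `r` after the history `h`, when servers
have capacity `b`: the assignment to a neighbor `s` with remaining capacity succeeds with the
probability of the edge. Choosing a server that is not eligible amounts to no assignment. -/
def outcome (b : ℕ) {n : ℕ} (h : History n) (r : Request n) : Option (Fin n) → PMF Bool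
  | none => PMF.pure false
  | some s =>
    match r s with
    | none => PMF.pure false
    | some q => if matchesOf h s < b then coin q else PMF.pure false

/-- The law of the final history, when the requests in the list arrive after the history `h`.
The outcomes of assignments are independent of past ones. -/
def play (b : ℕ) {n : ℕ} (A : History n → Request n → PMF (Option (Fin n))) :
    List (Request n) → History n → PMF (History n)
  | [], h => PMF.pure h
  | r :: rs, h =>
    (A h r).bind fun a => (outcome b h r a).bind fun x => play b A rs (⟨r, a, x⟩ :: h)

/-- The law of the number of matches of the algorithm `A` on the input `G`. -/
def matchLaw (b : ℕ) (A : Algorithm) (G : Input) : PMF ℕ :=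
  (play b (A G.numServers) (List.ofFn G.request) []).map totalMatches

/-- The expected number of matches of the algorithm `A` on the input `G`. (The sum is finite, since
the number of matches is at most the number of requests.) -/
def expectedMatches (b : ℕ) (A : Algorithm) (G : Input) : ℝ :=
  (∑' k : ℕ, matchLaw b A G k * (k : ℝ≥0∞)).toReal

namespace Input

/-- `{s, r}` is an edge. -/
def IsEdge (G : Input) (s : Fin G.numServers) (r : Fin G.numRequests) : Prop :=
  (G.request r s).isSome

/-- The success probability of the edge `{s, r}` (and `0` if there is no such edge). -/
def prob (G : Input) (s : Fin G.numServers) (r : Fin G.numRequests) : ℝ :=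
  (G.request r s).elim 0 fun q => (q : ℝ)

open Classical in
/-- Fractional solutions of the budgeted allocation problem with budgets `b`. -/
structure IsFeasible (b : ℕ) (G : Input) (m : Fin G.numServers → Fin G.numRequests → ℝ) :
    Prop where
  nonneg : ∀ s r, G.IsEdge s r → 0 ≤ m s r
  capacity : ∀ s, ∑ r with G.IsEdge s r, G.prob s r * m s r ≤ b
  assigned : ∀ r, ∑ s with G.IsEdge s r, m s r ≤ 1

open Classical in
/-- The total reward of a fractional solution. -/
def reward (G : Input) (m : Fin G.numServers → Fin G.numRequests → ℝ) : ℝ :=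
  ∑ s, ∑ r with G.IsEdge s r, G.prob s r * m s r

/-- The non-stochastic benchmark: the optimum of the fractional budgeted allocation problem.
(The set of rewards contains `0` and is bounded by `b` times the number of servers.) -/
def opt (b : ℕ) (G : Input) : ℝ :=
  sSup {v | ∃ m, IsFeasible b G m ∧ v = G.reward m}

/-- All edges have the same success probability `p`. -/
def HasEqualProb (p : ℝ) (G : Input) : Prop :=
  ∀ s r, G.IsEdge s r → G.prob s r = p

end Input

/-- The algorithm `A` is `c`-competitive against the non-stochastic benchmark on the class `𝒢` of
inputs, for server capacity `b`. -/
def IsCompetitiveOn (𝒢 : Set Input) (b : ℕ) (c : ℝ) (A : Algorithm) : Prop :=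
  ∀ G ∈ 𝒢, c * G.opt b ≤ expectedMatches b A G

end OnlineBMatching

end

namespace OnlineBMatching

/-! The hard instance is the upper triangular graph with randomly ranked servers: `n` blocks of `N =
⌊b/p⌋` requests, where block `j` sees the servers of rank at least `j`. Serving block `j` by the
server of rank `j` shows `Opt ≥ n * N * p`, close to `n * b`. While block `j` arrives, the servers
of rank at least `j` are still indistinguishable (`rankProb_swap`), so on average over the rankings
each request spreads success mass at most `p` evenly over `n - j` ranks. Ranks below `m` thus
collect at most `b * ∑ j < m, (m - j) / (n - j)` in total, and each of the other `n - m` ranks at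
most its capacity `b` (`sum_expectedMatches_le`). With `n - m ≈ n / e` the sum of the two bounds is
about `(1 - 1/e) * n * b` (`tendsto_triangular_bound`). Averaging over the rankings replaces Yao's
principle: a competitive algorithm would have to beat this bound on average. -/

/-- The expectation of an extended nonnegative function under a discrete law. -/
noncomputable def expect {α : Type*} (μ : PMF α) (f : α → ℝ≥0∞) : ℝ≥0∞ := ∑' a, μ a * f a

/-! ### Expectations under discrete laws -/

section Expect

variable {α β : Type*}

theorem expect_pure (a : α) (f : α → ℝ≥0∞) : expect (PMF.pure a) f = f a := by
  classical
  unfold expect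
  rw [tsum_eq_single a]
  · simp
  · intro c hc
    simp [PMF.pure_apply, hc]

theorem expect_bind (μ : PMF α) (κ : α → PMF β) (f : β → ℝ≥0∞) :
    expect (μ.bind κ) f = expect μ fun a => expect (κ a) f := by
  unfold expect
  simp_rw [PMF.bind_apply, ← ENNReal.tsum_mul_right, ← ENNReal.tsum_mul_left]
  rw [ENNReal.tsum_comm]
  simp_rw [mul_assoc]

theorem expect_map (μ : PMF α) (g : α → β) (f : β → ℝ≥0∞) :
    expect (μ.map g) f = expect μ (f ∘ g) := by
  rw [PMF.map, expect_bind]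
  simp only [Function.comp_apply, expect_pure]
  rfl

theorem expect_add (μ : PMF α) (f g : α → ℝ≥0∞) :
    expect μ (fun a => f a + g a) = expect μ f + expect μ g := by
  unfold expect
  simp_rw [mul_add]
  exact ENNReal.tsum_add

theorem expect_const (μ : PMF α) (c : ℝ≥0∞) : expect μ (fun _ => c) = c := by
  unfold expect
  rw [ENNReal.tsum_mul_right, μ.tsum_coe, one_mul]

theorem expect_le_of_support {μ : PMF α} {f : α → ℝ≥0∞} {c : ℝ≥0∞}
    (h : ∀ a, μ a ≠ 0 → f a ≤ c) : expect μ f ≤ c := by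
  rw [← expect_const μ c]
  refine ENNReal.tsum_le_tsum fun a => ?_
  by_cases ha : μ a = 0
  · simp [ha]
  · exact mul_le_mul_right (h a ha) _

theorem expect_sum {ι : Type*} (μ : PMF α) (s : Finset ι) (f : ι → α → ℝ≥0∞) :
    expect μ (fun a => ∑ i ∈ s, f i a) = ∑ i ∈ s, expect μ (f i) := by
  classical
  induction s using Finset.induction_on with
  | empty => simp [expect]
  | insert i s hi ih => simp_rw [Finset.sum_insert hi, expect_add, ih]

theorem expect_fintype [Fintype α] (μ : PMF α) (f : α → ℝ≥0∞) :
    expect μ f = ∑ a, μ a * f a := tsum_fintype _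

end Expect

/-! ### Match probabilities of single requests -/

section Play

variable {n : ℕ} (b : ℕ) (A : History n → Request n → PMF (Option (Fin n)))

theorem play_append (rs rs' : List (Request n)) (h : History n) :
    play b A (rs ++ rs') h = (play b A rs h).bind (play b A rs') := by
  induction rs generalizing h with
  | nil => simp [play]
  | cons r rs ih => simp [play, ih, PMF.bind_bind]

/-- `play` recurses on the first request; the accounting per request needs the last one split off.
-/
theorem expect_play_concat (rs : List (Request n)) (r : Request n) (h : History n)
    (f : History n → ℝ≥0∞) :
    expect (play b A (rs ++ [r]) h) f = expect (play b A rs h) fun h' =>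
      expect (A h' r) fun a => expect (outcome b h' r a) fun x => f (⟨r, a, x⟩ :: h') := by
  rw [play_append, expect_bind]
  simp only [play, expect_bind, expect_pure]

/-- The probability that the request `r`, arriving after the requests `rs`, is matched to `s`. -/
noncomputable def matchProb (rs : List (Request n)) (r : Request n) (s : Fin n) : ℝ≥0∞ :=
  expect (play b A rs []) fun h => A h r (some s) * outcome b h r (some s) true

theorem matchesOf_cons (h : History n) (r : Request n) (a : Option (Fin n)) (x : Bool)
    (s : Fin n) :
    matchesOf (⟨r, a, x⟩ :: h) s = matchesOf h s + if a = some s ∧ x = true then 1 else 0 := by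
  simp [matchesOf, List.countP_cons]

theorem totalMatches_cons (h : History n) (r : Request n) (a : Option (Fin n)) (x : Bool) :
    totalMatches (⟨r, a, x⟩ :: h) = totalMatches h + if x = true then 1 else 0 := by
  simp [totalMatches, List.countP_cons]

theorem expect_matchesOf_concat (rs : List (Request n)) (r : Request n) (s : Fin n) :
    expect (play b A (rs ++ [r]) []) (fun h => (matchesOf h s : ℝ≥0∞)) =
      expect (play b A rs []) (fun h => (matchesOf h s : ℝ≥0∞)) + matchProb b A rs r s := by
  rw [expect_play_concat, matchProb, ← expect_add]
  congr 1
  funext h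
  simp only [matchesOf_cons, Nat.cast_add, expect_add, expect_const]
  congr 1
  rw [expect_fintype, Finset.sum_eq_single (some s)]
  · rw [expect_fintype]
    simp
  · intro a _ ha
    simp [ha, expect_const]
  · simp

theorem expect_totalMatches_concat (rs : List (Request n)) (r : Request n) :
    expect (play b A (rs ++ [r]) []) (fun h => (totalMatches h : ℝ≥0∞)) =
      expect (play b A rs []) (fun h => (totalMatches h : ℝ≥0∞)) +
        ∑ s, matchProb b A rs r s := by
  simp only [matchProb]
  rw [expect_play_concat, ← expect_sum, ← expect_add]
  congr 1
  funext h
  simp only [totalMatches_cons, Nat.cast_add, expect_add, expect_const]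
  congr 1
  rw [expect_fintype, Fintype.sum_option]
  simp [expect_fintype, outcome, PMF.pure_apply]

/-- At a full server `outcome` is surely `false`, so no history in the support exceeds the capacity.
-/
theorem expect_matchesOf_le (rs : List (Request n)) (s : Fin n) (h : History n)
    (hh : matchesOf h s ≤ b) :
    expect (play b A rs h) (fun h => (matchesOf h s : ℝ≥0∞)) ≤ b := by
  induction rs generalizing h with
  | nil => simpa [play, expect_pure] using hh
  | cons r rs ih =>
    simp only [play, expect_bind]
    refine expect_le_of_support fun a _ => expect_le_of_support fun x hx => ih _ ?_
    rw [matchesOf_cons]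
    split_ifs with hax
    · obtain ⟨rfl, rfl⟩ := hax
      by_contra hlt
      apply hx
      have hb : ¬ matchesOf h s < b := by omega
      unfold outcome
      cases hr : r s <;> simp [hb, PMF.pure_apply, hr]
    · simpa using hh

theorem outcome_true_le {p : ℝ} (h : History n) (r : Request n) (s : Fin n)
    (hr : ∀ q ∈ r s, (q : ℝ) = p) : outcome b h r (some s) true ≤ ENNReal.ofReal p := by
  unfold outcome
  cases hrs : r s with
  | none => simp [PMF.pure_apply, hrs]
  | some q =>
    simp only [hrs]
    split_ifs
    · simp [coin, PMF.ofFintype_apply, hr q hrs]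
    · simp [PMF.pure_apply]

theorem matchProb_eq_zero (rs : List (Request n)) (r : Request n) (s : Fin n) (hr : r s = none) :
    matchProb b A rs r s = 0 := by
  simp [matchProb, outcome, hr, PMF.pure_apply, expect]

theorem sum_matchProb_le {p : ℝ} (rs : List (Request n)) (r : Request n)
    (hr : ∀ s, ∀ q ∈ r s, (q : ℝ) = p) :
    ∑ s, matchProb b A rs r s ≤ ENNReal.ofReal p := by
  simp only [matchProb]
  rw [← expect_sum]
  refine expect_le_of_support fun h _ => ?_
  calc ∑ s, A h r (some s) * outcome b h r (some s) true
      ≤ ∑ s, A h r (some s) * ENNReal.ofReal p :=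
        Finset.sum_le_sum fun s _ => mul_le_mul_right (outcome_true_le b h r s (hr s)) _
    _ = (∑ s, A h r (some s)) * ENNReal.ofReal p := by rw [Finset.sum_mul]
    _ ≤ 1 * ENNReal.ofReal p := by
        refine mul_le_mul_left ?_ _
        have := (A h r).tsum_coe
        rw [tsum_fintype, Fintype.sum_option] at this
        rw [← this]
        exact le_add_self
    _ = ENNReal.ofReal p := one_mul _

/-- The first `t` requests of a sequence. -/
def initialRequests (ρ : ℕ → Request n) (t : ℕ) : List (Request n) := (List.range t).map ρ

theorem initialRequests_succ (ρ : ℕ → Request n) (t : ℕ) :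
    initialRequests ρ (t + 1) = initialRequests ρ t ++ [ρ t] := by
  simp [initialRequests, List.range_succ]

/-- The match probabilities telescope to the expected load of `s`, which its capacity bounds. -/
theorem sum_matchProb_initialRequests_le (ρ : ℕ → Request n) (s : Fin n) (T : ℕ) :
    ∑ t ∈ Finset.range T, matchProb b A (initialRequests ρ t) (ρ t) s ≤ b := by
  have key : expect (play b A (initialRequests ρ T) []) (fun h => (matchesOf h s : ℝ≥0∞)) =
      ∑ t ∈ Finset.range T, matchProb b A (initialRequests ρ t) (ρ t) s := by
    induction T with
    | zero => simp [initialRequests, play, expect_pure, matchesOf]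
    | succ T ih => rw [initialRequests_succ, expect_matchesOf_concat, ih, Finset.sum_range_succ]
  rw [← key]
  exact expect_matchesOf_le b A _ s [] (by simp [matchesOf])

theorem expect_totalMatches_initialRequests (ρ : ℕ → Request n) (T : ℕ) :
    expect (play b A (initialRequests ρ T) []) (fun h => (totalMatches h : ℝ≥0∞)) =
      ∑ t ∈ Finset.range T, ∑ s, matchProb b A (initialRequests ρ t) (ρ t) s := by
  induction T with
  | zero => simp [initialRequests, play, expect_pure, totalMatches]
  | succ T ih => rw [initialRequests_succ, expect_totalMatches_concat, ih, Finset.sum_range_succ]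

end Play

/-! ### The triangular input and its rank symmetry -/

section Triangular

variable {n : ℕ}

/-- The request adjacent to the servers whose rank under `σ` is at least `j`. -/
def triRequest (q : unitInterval) (σ : Equiv.Perm (Fin n)) (j : ℕ) : Request n :=
  fun s => if j ≤ (σ s : ℕ) then some q else none

/-- The upper triangular input: for each rank `j < n`, a block of `N` requests that are adjacent
to the servers of rank at least `j`. -/
abbrev triInput (q : unitInterval) (N : ℕ) (σ : Equiv.Perm (Fin n)) : Input where
  numServers := n
  numRequests := n * N
  request t := triRequest q σ (t / N)

/-- The probability that request number `t` of the triangular input is matched to the server of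
rank `k`. -/
noncomputable def rankProb (b : ℕ) (A : Algorithm) (q : unitInterval) (N : ℕ)
    (σ : Equiv.Perm (Fin n)) (t : ℕ) (k : Fin n) : ℝ≥0∞ :=
  matchProb b (A n) (initialRequests (fun i => triRequest q σ (i / N)) t)
    (triRequest q σ (t / N)) (σ.symm k)

theorem triRequest_swap (q : unitInterval) (σ : Equiv.Perm (Fin n)) {i : ℕ} {j k : Fin n}
    (hj : i ≤ j) (hk : i ≤ k) : triRequest q (σ.trans (Equiv.swap j k)) i = triRequest q σ i := by
  funext s
  have : i ≤ (Equiv.swap j k (σ s) : ℕ) ↔ i ≤ (σ s : ℕ) := by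
    rw [Equiv.swap_apply_def]
    split_ifs with h1 h2
    · simp [h1, hj, hk]
    · simp [h2, hj, hk]
    · rfl
  simp [triRequest, this]

variable (b : ℕ) (A : Algorithm) (q : unitInterval) (N : ℕ)

/-- All requests up to number `t` belong to blocks at most `t / N`, so exchanging two ranks at or
above `t / N` leaves everything observed so far unchanged and only renames the server. -/
theorem rankProb_swap (σ : Equiv.Perm (Fin n)) {t : ℕ} {j k : Fin n}
    (hj : t / N ≤ j) (hk : t / N ≤ k) :
    rankProb b A q N (σ.trans (Equiv.swap j k)) t j = rankProb b A q N σ t k := by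
  have hpre : initialRequests (fun i => triRequest q (σ.trans (Equiv.swap j k)) (i / N)) t =
      initialRequests (fun i => triRequest q σ (i / N)) t := by
    refine List.map_congr_left fun i hi => ?_
    have : i / N ≤ t / N := Nat.div_le_div_right (List.mem_range.1 hi).le
    exact triRequest_swap q σ (this.trans hj) (this.trans hk)
  unfold rankProb
  rw [hpre, triRequest_swap q σ hj hk]
  simp

theorem rankProb_eq_zero (σ : Equiv.Perm (Fin n)) {t : ℕ} {k : Fin n} (hk : (k : ℕ) < t / N) :
    rankProb b A q N σ t k = 0 :=
  matchProb_eq_zero _ _ _ _ _ (by simp [triRequest, hk])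

theorem sum_rankProb_le (σ : Equiv.Perm (Fin n)) (t : ℕ) :
    ∑ k, rankProb b A q N σ t k ≤ ENNReal.ofReal q := by
  unfold rankProb
  rw [Equiv.sum_comp σ.symm fun s => matchProb b (A n)
    (initialRequests (fun i => triRequest q σ (i / N)) t) (triRequest q σ (t / N)) s]
  refine sum_matchProb_le b (A n) _ _ fun s q' hq' => ?_
  unfold triRequest at hq'
  split_ifs at hq' <;> simp_all

theorem sum_range_rankProb_le (σ : Equiv.Perm (Fin n)) (T : ℕ) (k : Fin n) :
    ∑ t ∈ Finset.range T, rankProb b A q N σ t k ≤ b :=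
  sum_matchProb_initialRequests_le b (A n) (fun i => triRequest q σ (i / N)) (σ.symm k) T

theorem expectedMatches_triInput (σ : Equiv.Perm (Fin n)) :
    expectedMatches b A (triInput q N σ) =
      (∑ t ∈ Finset.range (n * N), ∑ k, rankProb b A q N σ t k).toReal := by
  have hlist : List.ofFn (triInput q N σ).request =
      initialRequests (fun i => triRequest q σ (i / N)) (n * N) := by
    simp only [initialRequests, triInput]
    refine List.ext_getElem (by simp) fun i h1 h2 => by simp
  have hsum := expect_totalMatches_initialRequests b (A n) (fun i => triRequest q σ (i / N)) (n * N)
  have hex : (∑' k : ℕ, matchLaw b A (triInput q N σ) k * (k : ℝ≥0∞)) =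
      expect (matchLaw b A (triInput q N σ)) fun k => (k : ℝ≥0∞) := rfl
  rw [expectedMatches, hex, matchLaw, expect_map, hlist]
  refine congrArg ENNReal.toReal (hsum.trans (Finset.sum_congr rfl fun t _ => ?_))
  unfold rankProb
  rw [Equiv.sum_comp σ.symm fun s => matchProb b (A n)
    (initialRequests (fun i => triRequest q σ (i / N)) t) (triRequest q σ (t / N)) s]

/-- The sum over all rank assignments of the probability that request number `t` is matched to the
server of rank `k`. -/
noncomputable def rankTotal (n : ℕ) (t : ℕ) (k : Fin n) : ℝ :=
  (∑ σ : Equiv.Perm (Fin n), rankProb b A q N σ t k).toReal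

theorem rankProb_ne_top (σ : Equiv.Perm (Fin n)) (t : ℕ) (k : Fin n) :
    rankProb b A q N σ t k ≠ ∞ :=
  ne_top_of_le_ne_top ENNReal.ofReal_ne_top
    ((Finset.single_le_sum (f := fun k => rankProb b A q N σ t k) (fun _ _ => zero_le)
      (Finset.mem_univ k)).trans (sum_rankProb_le b A q N σ t))

theorem rankTotal_eq_sum (t : ℕ) (k : Fin n) :
    rankTotal b A q N n t k = ∑ σ : Equiv.Perm (Fin n), (rankProb b A q N σ t k).toReal :=
  ENNReal.toReal_sum fun σ _ => rankProb_ne_top b A q N σ t k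

theorem rankTotal_eq_zero {t : ℕ} {k : Fin n} (hk : (k : ℕ) < t / N) :
    rankTotal b A q N n t k = 0 := by
  simp [rankTotal, rankProb_eq_zero b A q N _ hk]

/-- Composition with a transposition permutes the rankings, so the sum over them turns
`rankProb_swap` into equality of totals. -/
theorem rankTotal_eq {t : ℕ} {j k : Fin n} (hj : t / N ≤ j) (hk : t / N ≤ k) :
    rankTotal b A q N n t k = rankTotal b A q N n t j := by
  unfold rankTotal
  rw [← Equiv.sum_comp (Equiv.mulLeft (Equiv.swap j k)) fun σ => rankProb b A q N σ t j]
  refine congrArg _ (Finset.sum_congr rfl fun σ _ => ?_)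
  exact (rankProb_swap b A q N σ hj hk).symm

theorem sum_rankTotal_le (t : ℕ) :
    ∑ k, rankTotal b A q N n t k ≤ n.factorial * (q : ℝ) := by
  simp_rw [rankTotal_eq_sum]
  rw [Finset.sum_comm]
  calc ∑ σ : Equiv.Perm (Fin n), ∑ k, (rankProb b A q N σ t k).toReal
      ≤ ∑ σ : Equiv.Perm (Fin n), (q : ℝ) := by
        refine Finset.sum_le_sum fun σ _ => ?_
        rw [← ENNReal.toReal_sum fun k _ => rankProb_ne_top b A q N σ t k]
        exact ENNReal.toReal_le_of_le_ofReal q.2.1 (sum_rankProb_le b A q N σ t)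
    _ = n.factorial * (q : ℝ) := by simp [Fintype.card_perm]

theorem sum_range_rankTotal_le (T : ℕ) (k : Fin n) :
    ∑ t ∈ Finset.range T, rankTotal b A q N n t k ≤ n.factorial * (b : ℝ) := by
  simp_rw [rankTotal_eq_sum]
  rw [Finset.sum_comm]
  calc ∑ σ : Equiv.Perm (Fin n), ∑ t ∈ Finset.range T, (rankProb b A q N σ t k).toReal
      ≤ ∑ σ : Equiv.Perm (Fin n), (b : ℝ) := by
        refine Finset.sum_le_sum fun σ _ => ?_
        rw [← ENNReal.toReal_sum fun t _ => rankProb_ne_top b A q N σ t k]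
        exact ENNReal.toReal_le_of_le_ofReal b.cast_nonneg
          (by simpa using sum_range_rankProb_le b A q N σ T k)
    _ = n.factorial * (b : ℝ) := by simp [Fintype.card_perm]

theorem sum_expectedMatches_triInput :
    ∑ σ : Equiv.Perm (Fin n), expectedMatches b A (triInput q N σ) =
      ∑ k, ∑ t ∈ Finset.range (n * N), rankTotal b A q N n t k := by
  simp_rw [expectedMatches_triInput, rankTotal_eq_sum]
  rw [Finset.sum_comm]
  simp_rw [fun t => Finset.sum_comm (s := Finset.univ) (t := Finset.univ)
    (f := fun (k : Fin n) (σ : Equiv.Perm (Fin n)) => (rankProb b A q N σ t k).toReal)]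
  rw [Finset.sum_comm]
  refine Finset.sum_congr rfl fun σ _ => ?_
  rw [ENNReal.toReal_sum fun t _ => ENNReal.sum_ne_top.2 fun k _ => rankProb_ne_top b A q N σ t k]
  exact Finset.sum_congr rfl fun t _ =>
    ENNReal.toReal_sum fun k _ => rankProb_ne_top b A q N σ t k

/-- A request of block `j` is matched to a server of rank less than `m` with probability at most
`(m - j) / (n - j)` times the success probability, on average over the rank assignments. -/
theorem sum_rankTotal_lt_le {m : ℕ} (hm : m ≤ n) (t : ℕ) :
    ∑ k ∈ Finset.univ.filter (fun k : Fin n => (k : ℕ) < m), rankTotal b A q N n t k ≤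
      n.factorial * (q : ℝ) * (((m - t / N : ℕ) : ℝ) / (n - (t / N : ℕ))) := by
  set j := t / N with hjdef
  rcases le_or_gt m j with hmj | hjm
  · rw [Nat.sub_eq_zero_of_le hmj, Finset.sum_eq_zero]
    · simp
    · intro k hk
      exact rankTotal_eq_zero b A q N (lt_of_lt_of_le (Finset.mem_filter.1 hk).2 hmj)
  · have hjn : j < n := hjm.trans_le hm
    set y := rankTotal b A q N n t ⟨j, hjn⟩ with hy
    have hval : ∀ k : Fin n, rankTotal b A q N n t k = if j ≤ (k : ℕ) then y else 0 := by
      intro k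
      split_ifs with hk
      · exact rankTotal_eq b A q N (j := ⟨j, hjn⟩) le_rfl hk
      · exact rankTotal_eq_zero b A q N (not_le.1 hk)
    -- Stated for every bound because it is used twice: at `n` it gives `(n - j) * y ≤ n! * q`, and
    -- at the given `m` it gives the sum to be estimated.
    have hcount : ∀ m ≤ n, ∑ k ∈ Finset.univ.filter (fun k : Fin n => (k : ℕ) < m),
        rankTotal b A q N n t k = ((m - j : ℕ) : ℝ) * y := by
      intro m hm
      simp_rw [hval]
      rw [Finset.sum_filter, Finset.sum_congr rfl (g := fun k : Fin n =>
        (fun i : ℕ => if i < m then (if j ≤ i then y else 0) else 0) k) (fun _ _ => rfl),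
        Fin.sum_univ_eq_sum_range (fun i : ℕ => if i < m then (if j ≤ i then y else 0) else 0) n]
      simp_rw [← ite_and]
      rw [← Finset.sum_filter, Finset.sum_const, nsmul_eq_mul]
      congr 2
      rw [← Nat.card_Ico]
      congr 1
      ext i
      simp only [Finset.mem_filter, Finset.mem_range, Finset.mem_Ico]
      omega
    have hall := sum_rankTotal_le (n := n) b A q N t
    have huniv : (Finset.univ.filter fun k : Fin n => (k : ℕ) < n) = Finset.univ := by
      ext k; simp
    have hn := hcount n le_rfl
    rw [huniv] at hn
    rw [hn, Nat.cast_sub hjn.le] at hall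
    have hpos : (0 : ℝ) < n - j := sub_pos.2 (by exact_mod_cast hjn)
    rw [hcount m hm, mul_div_assoc', le_div_iff₀ hpos]
    nlinarith [Nat.cast_nonneg (α := ℝ) (m - j)]

theorem sum_range_mul_div (hN : 0 < N) (f : ℕ → ℝ) (n : ℕ) :
    ∑ t ∈ Finset.range (n * N), f (t / N) = N * ∑ j ∈ Finset.range n, f j := by
  induction n with
  | zero => simp
  | succ n ih =>
    rw [Nat.succ_mul, Finset.sum_range_add, ih, Finset.sum_range_succ, mul_add]
    congr 1
    rw [← nsmul_eq_mul]
    conv_rhs => rw [← Finset.card_range N]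
    rw [← Finset.sum_const]
    refine Finset.sum_congr rfl fun i hi => ?_
    rw [mul_comm, Nat.mul_add_div hN, Nat.div_eq_of_lt (Finset.mem_range.1 hi), add_zero]

/-- Low ranks are charged by symmetry, high ranks by capacity; the cut `m` stays free to be
optimized. -/
theorem sum_expectedMatches_le (hN : 0 < N) (hNb : (N : ℝ) * q ≤ b) {m : ℕ} (hm : m ≤ n) :
    ∑ σ : Equiv.Perm (Fin n), expectedMatches b A (triInput q N σ) ≤
      n.factorial * (b * (n - (n - m) * ∑ j ∈ Finset.range m, 1 / ((n : ℝ) - j))) := by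
  rw [sum_expectedMatches_triInput, ← Finset.sum_filter_add_sum_filter_not _ fun k : Fin n =>
    (k : ℕ) < m]
  have hfac : (0 : ℝ) ≤ n.factorial := Nat.cast_nonneg _
  -- Truncated subtraction kills the terms with `j ≥ m`; the others are `1 - (n - m) / (n - j)`.
  have hsum : ∑ j ∈ Finset.range n, ((m - j : ℕ) : ℝ) / (n - (j : ℕ)) =
      m - (n - m) * ∑ j ∈ Finset.range m, 1 / ((n : ℝ) - j) := by
    rw [← Finset.sum_subset (Finset.range_subset_range.2 hm), Finset.mul_sum]
    · calc ∑ j ∈ Finset.range m, ((m - j : ℕ) : ℝ) / (n - (j : ℕ))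
          = ∑ j ∈ Finset.range m, (1 - ((n : ℝ) - m) * (1 / ((n : ℝ) - j))) := by
            refine Finset.sum_congr rfl fun j hj => ?_
            have hjm := Finset.mem_range.1 hj
            have : (0 : ℝ) < n - j := sub_pos.2 (by exact_mod_cast hjm.trans_le hm)
            rw [Nat.cast_sub hjm.le]
            field_simp
            ring
        _ = _ := by simp
    · intro j _ hj
      rw [Nat.sub_eq_zero_of_le (by simpa using hj)]
      simp
  have hS : 0 ≤ ∑ j ∈ Finset.range n, ((m - j : ℕ) : ℝ) / (n - (j : ℕ)) := by
    refine Finset.sum_nonneg fun j hj => div_nonneg (Nat.cast_nonneg _) (sub_nonneg.2 ?_)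
    exact_mod_cast (Finset.mem_range.1 hj).le
  have hlow : ∑ k ∈ Finset.univ.filter (fun k : Fin n => (k : ℕ) < m),
      ∑ t ∈ Finset.range (n * N), rankTotal b A q N n t k ≤
      n.factorial * (b * ∑ j ∈ Finset.range n, ((m - j : ℕ) : ℝ) / (n - (j : ℕ))) := by
    rw [Finset.sum_comm]
    refine (Finset.sum_le_sum fun t _ => sum_rankTotal_lt_le b A q N hm t).trans ?_
    rw [← Finset.mul_sum,
      sum_range_mul_div N hN (fun j => ((m - j : ℕ) : ℝ) / (n - (j : ℕ))) n]
    calc _ = n.factorial * ((N * (q : ℝ)) *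
          ∑ j ∈ Finset.range n, ((m - j : ℕ) : ℝ) / (n - (j : ℕ))) := by ring
      _ ≤ _ := by gcongr
  have hhigh : ∑ k ∈ Finset.univ.filter (fun k : Fin n => ¬ (k : ℕ) < m),
      ∑ t ∈ Finset.range (n * N), rankTotal b A q N n t k ≤ (n - m) * (n.factorial * b) := by
    refine (Finset.sum_le_sum fun k _ => sum_range_rankTotal_le b A q N (n * N) k).trans ?_
    rw [Finset.sum_const, nsmul_eq_mul]
    refine le_of_eq ?_
    congr 1
    have hc : (Finset.univ.filter fun k : Fin n => ¬ (k : ℕ) < m).card = n - m := by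
      rw [Finset.filter_not, Finset.card_sdiff_of_subset (Finset.filter_subset _ _),
        Fin.card_filter_val_lt]
      simp [hm]
    rw [hc, Nat.cast_sub hm]
  rw [hsum] at hlow
  linarith

/-! ### The benchmark on triangular inputs -/

theorem isEdge_triInput (σ : Equiv.Perm (Fin n)) (s : Fin n) (r : Fin (n * N)) :
    (triInput q N σ).IsEdge s r ↔ (r : ℕ) / N ≤ (σ s : ℕ) := by
  simp only [Input.IsEdge, triRequest]
  split_ifs with h <;> simp [h]

theorem prob_triInput (σ : Equiv.Perm (Fin n)) (s : Fin n) (r : Fin (n * N))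
    (h : (triInput q N σ).IsEdge s r) : (triInput q N σ).prob s r = q := by
  rw [isEdge_triInput] at h
  simp [Input.prob, triRequest, h]

theorem Input.le_opt {b : ℕ} {G : Input} {m : Fin G.numServers → Fin G.numRequests → ℝ}
    (hm : Input.IsFeasible b G m) : G.reward m ≤ G.opt b := by
  refine le_csSup ⟨∑ _s : Fin G.numServers, (b : ℝ), ?_⟩ ⟨m, hm, rfl⟩
  rintro v ⟨m', hm', rfl⟩
  exact Finset.sum_le_sum fun s _ => hm'.capacity s

theorem le_opt_triInput (hN : 0 < N) (hNb : (N : ℝ) * q ≤ b) (σ : Equiv.Perm (Fin n)) :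
    n * (N * (q : ℝ)) ≤ (triInput q N σ).opt b := by
  classical
  -- Block `j` goes entirely to the server of rank `j`, which receives reward `N * q ≤ b`.
  let m : Fin n → Fin (n * N) → ℝ := fun s r => if (r : ℕ) / N = σ s then 1 else 0
  have hrow : ∀ s : Fin n, ∑ r : Fin (n * N) with (triInput q N σ).IsEdge s r,
      (triInput q N σ).prob s r * m s r = N * q := by
    intro s
    calc ∑ r : Fin (n * N) with (triInput q N σ).IsEdge s r, (triInput q N σ).prob s r * m s r
        = ∑ r : Fin (n * N), if (r : ℕ) / N = σ s then (q : ℝ) else 0 := by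
          rw [Finset.sum_filter]
          refine Finset.sum_congr rfl fun r _ => ?_
          split_ifs with h1 h2 h2
          · rw [prob_triInput q N σ s r h1]
            simp [m, h2]
          · simp [m, h2]
          · exact absurd ((isEdge_triInput q N σ s r).2 h2.le) h1
          · rfl
      _ = ∑ t ∈ Finset.range (n * N), if t / N = σ s then (q : ℝ) else 0 :=
          Fin.sum_univ_eq_sum_range (fun t => if t / N = (σ s : ℕ) then (q : ℝ) else 0) (n * N)
      _ = N * q := by
          rw [sum_range_mul_div N hN (fun j => if j = (σ s : ℕ) then (q : ℝ) else 0)]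
          simp
  have hfeas : Input.IsFeasible b (triInput q N σ) m := by
    refine ⟨fun s r _ => ?_, fun s => ?_, fun r => ?_⟩
    · simp only [m]
      split_ifs <;> norm_num
    · exact (hrow s).le.trans hNb
    · have hr : (r : ℕ) / N < n := Nat.div_lt_of_lt_mul (by rw [mul_comm]; exact r.2)
      have hcol : ∑ s : Fin n, m s r = 1 := by
        rw [Finset.sum_eq_single (σ.symm ⟨_, hr⟩)]
        · simp [m]
        · intro s _ hs
          simp only [m, ite_eq_right_iff, one_ne_zero, imp_false]
          intro h
          apply hs
          rw [Equiv.eq_symm_apply]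
          exact Fin.ext h.symm
        · simp
      rw [← hcol]
      refine Finset.sum_le_sum_of_subset_of_nonneg (Finset.filter_subset _ _) fun s _ _ => ?_
      simp only [m]
      split_ifs <;> norm_num
  refine le_trans (le_of_eq ?_) (Input.le_opt hfeas)
  calc n * (N * (q : ℝ)) = ∑ _s : Fin n, (N * (q : ℝ)) := by simp
    _ = _ := Finset.sum_congr rfl fun s _ => (hrow s).symm

theorem le_of_isCompetitiveOn {c : ℝ} (hc : 0 ≤ c) (hN : 0 < N) (hNb : (N : ℝ) * q ≤ b)
    (hA : IsCompetitiveOn {G | G.HasEqualProb q} b c A) {m : ℕ} (hm : m ≤ n) :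
    c * (n * (N * q)) ≤ b * (n - (n - m) * ∑ j ∈ Finset.range m, 1 / ((n : ℝ) - j)) := by
  have hle := sum_expectedMatches_le b A q N hN hNb hm
  have hge : ∑ _σ : Equiv.Perm (Fin n), c * (n * (N * (q : ℝ))) ≤
      ∑ σ : Equiv.Perm (Fin n), expectedMatches b A (triInput q N σ) := by
    refine Finset.sum_le_sum fun σ _ => ?_
    exact (mul_le_mul_of_nonneg_left (le_opt_triInput b q N hN hNb σ) hc).trans
      (hA _ fun s r h => prob_triInput q N σ s r h)
  have hall := hge.trans hle
  rw [Finset.sum_const, nsmul_eq_mul, Finset.card_univ, Fintype.card_perm, Fintype.card_fin] at hall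
  exact le_of_mul_le_mul_left hall (Nat.cast_pos.2 n.factorial_pos)

end Triangular

/-! ### Asymptotics of the triangular bound -/

/-- Each term satisfies `1 / x ≥ log ((x + 1) / x)`, and these logarithms telescope. -/
theorem log_div_le_sum {n m : ℕ} (hm : m ≤ n) :
    Real.log ((n + 1) / ((n - m) + 1)) ≤ ∑ j ∈ Finset.range m, 1 / ((n : ℝ) - j) := by
  induction m with
  | zero =>
    have : (n : ℝ) + 1 ≠ 0 := by positivity
    simp [this]
  | succ m ih =>
    rw [Finset.sum_range_succ]
    have hpos : (0 : ℝ) < n - m := sub_pos.2 (by exact_mod_cast hm)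
    have ih := ih (by omega)
    have hn : (0 : ℝ) < n + 1 := by positivity
    have hlog : Real.log (((n : ℝ) - m + 1) / (n - m)) ≤ 1 / ((n : ℝ) - m) := by
      refine (Real.log_le_sub_one_of_pos (by positivity)).trans (le_of_eq ?_)
      field_simp
      ring
    rw [Real.log_div (by positivity) (by positivity)] at ih hlog
    push_cast
    rw [show (n : ℝ) - (m + 1) + 1 = n - m by ring, Real.log_div (by positivity) (by positivity)]
    linarith

theorem tendsto_triangular_bound :
    Tendsto (fun n : ℕ => 1 - ((⌊Real.exp (-1) * n⌋₊ : ℝ) / n) *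
      Real.log ((n + 1) / (⌊Real.exp (-1) * n⌋₊ + 1))) atTop (𝓝 (1 - 1 / Real.exp 1)) := by
  have h1 : Tendsto (fun n : ℕ => (⌊Real.exp (-1) * n⌋₊ : ℝ) / n) atTop (𝓝 (Real.exp (-1))) :=
    (tendsto_nat_floor_mul_div_atTop (Real.exp_pos (-1)).le).comp tendsto_natCast_atTop_atTop
  have h0 : Tendsto (fun n : ℕ => 1 / (n : ℝ)) atTop (𝓝 0) := tendsto_one_div_atTop_nhds_zero_nat
  have h2 : Tendsto (fun n : ℕ => (n + 1 : ℝ) / (⌊Real.exp (-1) * n⌋₊ + 1)) atTop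
      (𝓝 (Real.exp 1)) := by
    have := (h0.const_add 1).div (h1.add h0) (by simp [Real.exp_ne_zero])
    rw [add_zero, add_zero, one_div, ← Real.exp_neg, neg_neg] at this
    refine this.congr' ?_
    filter_upwards [eventually_gt_atTop 0] with n hn
    have hn' : (0 : ℝ) < n := by exact_mod_cast hn
    simp only [Pi.div_apply]
    field_simp
  have h3 := h2.log (Real.exp_ne_zero 1)
  rw [Real.log_exp] at h3
  have := (h1.mul h3).const_sub 1
  rw [mul_one] at this
  rwa [one_div, ← Real.exp_neg]

/-- On large triangular inputs the average of the algorithm stays below any fraction greater than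
`1 - 1 / e` of the total capacity. -/
theorem exists_triangular_bound_lt {c : ℝ} (hc : 1 - 1 / Real.exp 1 < c) :
    ∃ n m : ℕ, 0 < n ∧ m ≤ n ∧
      (n : ℝ) - (n - m) * ∑ j ∈ Finset.range m, 1 / ((n : ℝ) - j) < c * n := by
  obtain ⟨n, hlt, hn⟩ :=
    ((tendsto_triangular_bound.eventually_lt_const hc).and (eventually_gt_atTop 0)).exists
  set k := ⌊Real.exp (-1) * n⌋₊ with hk
  have hn' : (0 : ℝ) < n := by exact_mod_cast hn
  have hkn : k ≤ n := by
    refine Nat.floor_le_of_le ?_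
    have : Real.exp (-1) ≤ 1 := Real.exp_le_one_iff.2 (by norm_num)
    nlinarith
  -- With a fraction `x = k / n` of high ranks the bound is about `1 - x * log (1 / x)`, smallest at
  -- `x = 1 / e`.
  refine ⟨n, n - k, hn, Nat.sub_le _ _, ?_⟩
  have hlog := log_div_le_sum (Nat.sub_le n k)
  have hcast : (n : ℝ) - ((n - k : ℕ) : ℝ) = k := by
    rw [Nat.cast_sub hkn]
    ring
  rw [hcast] at hlog ⊢
  have hle := mul_le_mul_of_nonneg_left hlog (Nat.cast_nonneg (α := ℝ) k)
  have hmul := mul_lt_mul_of_pos_right hlt hn'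
  have heq : (1 - (k : ℝ) / n * Real.log ((n + 1) / (k + 1))) * n =
      n - k * Real.log ((n + 1) / (k + 1)) := by
    field_simp
  linarith

end OnlineBMatching

theorem mainTheorem2 (b : ℕ) (hb : 1 ≤ b) (c : ℝ) (hc : 1 - 1 / Real.exp 1 < c) :
    ∀ᶠ p : ℝ in 𝓝[>] 0, ∀ A : OnlineBMatching.Algorithm,
      ¬ OnlineBMatching.IsCompetitiveOn {G | G.HasEqualProb p} b c A := by
  -- The graph size depends on `c` alone; only the block length depends on `p`.
  obtain ⟨n, m, hn, hm, hlt⟩ := OnlineBMatching.exists_triangular_bound_lt hc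
  have hn' : (0 : ℝ) < n := by exact_mod_cast hn
  have hb' : (1 : ℝ) ≤ b := by exact_mod_cast hb
  have hc0 : 0 < c := by
    have : 1 / Real.exp 1 < 1 := by
      rw [one_div, ← Real.exp_neg]
      simp
    linarith
  set B := (n : ℝ) - (n - m) * ∑ j ∈ Finset.range m, 1 / ((n : ℝ) - j) with hB
  -- Rounding `b / p` down costs less than `p` per server, which the strict gap `B < c * n` absorbs
  -- for small `p`.
  have hsmall : ∀ᶠ p : ℝ in 𝓝[>] 0, b * B < c * (n * (b - p)) := by
    refine nhdsWithin_le_nhds ?_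
    have hcont : ContinuousAt (fun p : ℝ => c * (n * (b - p))) 0 := by fun_prop
    refine hcont.eventually_const_lt ?_
    have := mul_lt_mul_of_pos_left hlt (by linarith : (0 : ℝ) < b)
    linarith
  have hone : ∀ᶠ p : ℝ in 𝓝[>] 0, p < 1 :=
    nhdsWithin_le_nhds (eventually_lt_nhds one_pos)
  filter_upwards [hsmall, hone, self_mem_nhdsWithin] with p hp hp1 hp0 A hA
  have hp0 : 0 < p := hp0
  have hfloor : (⌊(b : ℝ) / p⌋₊ : ℝ) * p ≤ b := by
    rw [← le_div_iff₀ hp0]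
    exact Nat.floor_le (by positivity)
  have hfloor' : (b : ℝ) - p < ⌊(b : ℝ) / p⌋₊ * p := by
    have := Nat.lt_floor_add_one ((b : ℝ) / p)
    rw [div_lt_iff₀ hp0] at this
    linarith
  have hN : 0 < ⌊(b : ℝ) / p⌋₊ := by
    rw [Nat.floor_pos, le_div_iff₀ hp0]
    linarith
  have hle := OnlineBMatching.le_of_isCompetitiveOn b A ⟨p, hp0.le, hp1.le⟩ _ hc0.le hN hfloor hA hm
  have : c * (n * (b - p)) < c * (n * (⌊(b : ℝ) / p⌋₊ * p)) := by gcongr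
  exact absurd hle (not_le.2 (hp.trans this))
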